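/- Let $V_{-\infty}$ be the space of all continuously differentiable functions $\tau\colon[0,\infty)\to\mathbb{C}$ such that $\tau'(x)\to 0$ as $x\to\infty$ and such that the Laplace transform $$\mathcal{L}\{\tau;s\}=\int_0^\infty \tau(x)e^{-sx}\,dx,$$ which converges absolutely for $\operatorname{Re}s>0$, extends to an entire function on $\mathbb{C}$. Theorem. Let $\rho\colon[0,\infty)\to(0,\infty)$ be an arbitrary function with $\rho(x)\to 0$ as $x\to\infty$. Then there is $\tau\in V_{-\infty}$ such that $$\limsup_{x\to\infty}\frac{|\tau(x)|}{\rho(x)}=\infty .$$ -/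

import Mathlib

open Filter Topology

/-- The (one-sided) Laplace transform `∫₀^∞ τ(x) e^{-s x} dx` of a function on `[0, ∞)`. -/
noncomputable def laplaceTransform (τ : ℝ → ℂ) (s : ℂ) : ℂ :=
  ∫ x in Set.Ioi (0 : ℝ), τ x * Complex.exp (-s * x)

/-- The space of all complex-valued `τ ∈ C¹[0, ∞)` with `τ'(x) → 0` as `x → ∞` whose Laplace
transform extends to an entire function. A function on `[0, ∞)` is represented by a function on
`ℝ` whose values at negative numbers play no role. Since `τ' = o(1)` gives `τ(x) = O(1 + x)`,
the integral that defines the Laplace transform converges absolutely for `0 < re s`; that is the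
half-plane on which the entire function has to agree with it. -/
def VNegInfty : Set (ℝ → ℂ) :=
  {τ | ContDiffOn ℝ 1 τ (Set.Ici 0) ∧
    Tendsto (derivWithin τ (Set.Ici 0)) atTop (𝓝 0) ∧
    ∃ F : ℂ → ℂ, Differentiable ℂ F ∧ ∀ s : ℂ, 0 < s.re → F s = laplaceTransform τ s}

open MeasureTheory ProbabilityTheory

/-! A Gaussian packet of frequency `l`, centre `m`, variance `m / l` has an entire Laplace
transform. Its oscillation contributes a factor of order `e^{-lm/2}`, which beats the growth
`e^{Rm}` on `‖s‖ ≤ R` once `l` is large compared with `R`. So all packets of high frequency obey one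
bound there, wherever they are centred (`norm_laplaceTransform_wavePacket_le`). With weights `2⁻ⁿ`
and frequencies `n + 1`, the sum of the transforms is therefore entire for every choice of centres
`m n ≥ 1`. The derivatives are also dominated independently of the centres, so they sum to a
function tending to `0`. The centres may thus be taken so far out that `ρ (m n) ≤ 4⁻ⁿ`, while
sparseness keeps the sum at `m n` at least `2⁻ⁿ / 2` (`le_norm_wavePacketSum`). -/

/-- The wave packet `e^{ilx}` with a Gaussian envelope of mean `m` and variance `m / l`. -/
noncomputable def wavePacket (l m x : ℝ) : ℂ :=
  Complex.exp (Complex.I * l * x - l * (x - m) ^ 2 / (2 * m))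

/-! ### Pointwise bounds on a packet -/

lemma norm_wavePacket (l m x : ℝ) :
    ‖wavePacket l m x‖ = Real.exp (-(l * (x - m) ^ 2 / (2 * m))) := by
  have h : (Complex.I * l * x - l * (x - m) ^ 2 / (2 * m) : ℂ)
      = ((-(l * (x - m) ^ 2 / (2 * m)) : ℝ) : ℂ) + ((l * x : ℝ) : ℂ) * Complex.I := by
    push_cast; ring
  rw [wavePacket, Complex.norm_exp, h]
  simp only [Complex.add_re, Complex.ofReal_re, Complex.re_ofReal_mul, Complex.I_re, mul_zero,
    add_zero]

lemma norm_wavePacket_le_one {l m : ℝ} (hl : 0 ≤ l) (hm : 0 ≤ m) (x : ℝ) :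
    ‖wavePacket l m x‖ ≤ 1 := by
  rw [norm_wavePacket, Real.exp_le_one_iff]
  have : 0 ≤ l * (x - m) ^ 2 / (2 * m) := by positivity
  linarith

lemma norm_wavePacket_self (l m : ℝ) : ‖wavePacket l m m‖ = 1 := by
  simp [norm_wavePacket]

lemma continuous_wavePacket (l m : ℝ) : Continuous (wavePacket l m) := by
  unfold wavePacket
  fun_prop

lemma hasDerivAt_wavePacket (l m x : ℝ) :
    HasDerivAt (wavePacket l m)
      ((Complex.I * l - l * (2 * (x - m)) / (2 * m)) * wavePacket l m x) x := by
  have h1 : HasDerivAt (fun y : ℝ => (y : ℂ)) 1 x := Complex.ofRealCLM.hasDerivAt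
  have h2 := ((h1.const_mul (Complex.I * l)).sub
    ((((h1.sub_const (m : ℂ)).pow 2).const_mul (l : ℂ)).div_const (2 * m : ℂ))).cexp
  convert! h2 using 1
  simp [wavePacket]
  ring

/-- The Gaussian absorbs the linear factor. The result serves twice: as the bound `l * exp 2`,
uniform in `m` and `x`, and as decay in `x`. -/
lemma norm_deriv_wavePacket_le {l m : ℝ} (hl : 1 ≤ l) (hm : 1 ≤ m) (x : ℝ) :
    ‖(Complex.I * l - l * (2 * (x - m)) / (2 * m)) * wavePacket l m x‖
      ≤ l * Real.exp (2 - |x - m| / m) := by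
  have hm0 : 0 < m := by linarith
  set w := |x - m| / m with hw
  have hw0 : 0 ≤ w := by positivity
  have h1 : ‖(Complex.I * l - l * (2 * (x - m)) / (2 * m) : ℂ)‖ ≤ l * (1 + w) := by
    have e : (Complex.I * l - l * (2 * (x - m)) / (2 * m) : ℂ)
        = (l : ℂ) * (Complex.I - (((x - m) / m : ℝ) : ℂ)) := by
      have : (m : ℂ) ≠ 0 := by exact_mod_cast hm0.ne'
      push_cast
      field_simp
    rw [e, norm_mul, Complex.norm_real, Real.norm_of_nonneg (by linarith)]
    gcongr
    refine (norm_sub_le _ _).trans ?_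
    rw [Complex.norm_I, Complex.norm_real, Real.norm_eq_abs, abs_div, abs_of_pos hm0]
  have h2 : ‖wavePacket l m x‖ ≤ Real.exp (-(w ^ 2 / 2)) := by
    rw [norm_wavePacket, Real.exp_le_exp, neg_le_neg_iff]
    have e : l * (x - m) ^ 2 / (2 * m) = (l * m) * (w ^ 2 / 2) := by
      rw [hw, div_pow, sq_abs]
      field_simp
    rw [e]
    have : 1 ≤ l * m := by nlinarith
    nlinarith [sq_nonneg w]
  have h3 : (1 + w) * Real.exp (-(w ^ 2 / 2)) ≤ Real.exp (2 - w) := by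
    calc (1 + w) * Real.exp (-(w ^ 2 / 2)) ≤ Real.exp w * Real.exp (-(w ^ 2 / 2)) := by
          gcongr
          linarith [Real.add_one_le_exp w]
      _ = Real.exp (w + -(w ^ 2 / 2)) := (Real.exp_add _ _).symm
      _ ≤ Real.exp (2 - w) := by
          gcongr
          -- The constant 2 comes from `w - w ^ 2 / 2 = 2 - w - (w - 2) ^ 2 / 2`.
          nlinarith [sq_nonneg (w - 2)]
  rw [norm_mul]
  calc _ ≤ (l * (1 + w)) * Real.exp (-(w ^ 2 / 2)) := by gcongr
    _ = l * ((1 + w) * Real.exp (-(w ^ 2 / 2))) := by ring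
    _ ≤ _ := by gcongr

/-- A wave packet is exponentially small away from its centre, on the scale set by the ratio of the
two points. -/
lemma norm_wavePacket_le_exp {l m x : ℝ} (hl : 1 ≤ l) (hm : 0 < m) (hx : 0 < x)
    (h : 4 * m ≤ x ∨ 4 * x ≤ m) : ‖wavePacket l m x‖ ≤ Real.exp (-x) := by
  rw [norm_wavePacket]
  gcongr
  rw [le_div_iff₀ (by positivity)]
  have key : x * (2 * m) ≤ (x - m) ^ 2 := by
    rcases h with h | h <;> nlinarith
  nlinarith [sq_nonneg (x - m)]

/-! ### Laplace transform of one packet -/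

lemma interior_integrableExpSet_gaussianReal_restrict (m : ℝ) (v : NNReal) (s : Set ℝ) :
    interior (integrableExpSet id ((gaussianReal m v).restrict s)) = Set.univ := by
  have : integrableExpSet id ((gaussianReal m v).restrict s) = Set.univ :=
    Set.eq_univ_of_forall fun t => (integrable_exp_mul_gaussianReal t).restrict
  rw [this, interior_univ]

lemma laplaceTransform_wavePacket {l m : ℝ} (hl : 0 < l) (hm : 0 < m) (s : ℂ) :
    laplaceTransform (wavePacket l m) s = (√(2 * Real.pi * (m / l)) : ℝ) *
      complexMGF id ((gaussianReal m (m / l).toNNReal).restrict (Set.Ioi 0))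
        (Complex.I * l - s) := by
  have hv : (m / l).toNNReal ≠ 0 := by
    simp only [ne_eq, Real.toNNReal_eq_zero, not_le]
    positivity
  have hcoe : ((m / l).toNNReal : ℝ) = m / l := Real.coe_toNNReal _ (by positivity)
  have hs : (√(2 * Real.pi * (m / l)) : ℝ) ≠ 0 := by positivity
  rw [laplaceTransform, complexMGF, ← integral_indicator measurableSet_Ioi,
    ← integral_indicator measurableSet_Ioi, integral_gaussianReal_eq_integral_smul hv,
    ← integral_const_mul]
  congr 1
  ext x
  by_cases hx : x ∈ Set.Ioi (0 : ℝ)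
  · simp only [Set.indicator_of_mem hx, id, gaussianPDFReal, hcoe, Complex.real_smul]
    push_cast
    have hs' : ((√(2 * Real.pi * (m / l)) : ℝ) : ℂ) ≠ 0 := by exact_mod_cast hs
    rw [← mul_assoc, ← mul_assoc, mul_inv_cancel₀ hs', one_mul, wavePacket, ← Complex.exp_add,
      ← Complex.exp_add]
    congr 1
    have : (m : ℂ) ≠ 0 := by exact_mod_cast hm.ne'
    have : (l : ℂ) ≠ 0 := by exact_mod_cast hl.ne'
    field_simp
    ring
  · simp [Set.indicator_of_notMem hx]

lemma differentiable_laplaceTransform_wavePacket {l m : ℝ} (hl : 0 < l) (hm : 0 < m) :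
    Differentiable ℂ (laplaceTransform (wavePacket l m)) := by
  have h : Differentiable ℂ
      (complexMGF id ((gaussianReal m (m / l).toNNReal).restrict (Set.Ioi 0))) := by
    have := differentiableOn_complexMGF (X := id)
      (μ := (gaussianReal m (m / l).toNNReal).restrict (Set.Ioi 0))
    rw [interior_integrableExpSet_gaussianReal_restrict] at this
    exact differentiableOn_univ.1 (by simpa using this)
  rw [funext (laplaceTransform_wavePacket hl hm)]
  exact (h.comp ((differentiable_const _).sub differentiable_id)).const_mul _

lemma integrable_cexp_mul_gaussianReal (m : ℝ) (v : NNReal) (z : ℂ) :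
    Integrable (fun x : ℝ => Complex.exp (z * (id x : ℝ))) (gaussianReal m v) := by
  refine (integrable_exp_mul_gaussianReal (μ := m) (v := v) z.re).mono'
    (by fun_prop) (Eventually.of_forall fun x => ?_)
  simp [Complex.norm_exp]

/-- The half-line integral is the full Gaussian integral, known in closed form, minus the part over
`x ≤ 0`, controlled by a Chernoff bound. -/
lemma norm_complexMGF_gaussianReal_Ioi_le {l m R : ℝ} (hm : 0 < m)
    (hR : 0 ≤ R) (hlR : 4 * R + 2 ≤ l) {s : ℂ} (hs : ‖s‖ ≤ R) :
    ‖complexMGF id ((gaussianReal m (m / l).toNNReal).restrict (Set.Ioi 0)) (Complex.I * l - s)‖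
      ≤ 2 * Real.exp (-m) := by
  have hl : 0 < l := by linarith
  have hcoe : ((m / l).toNNReal : ℝ) = m / l := Real.coe_toNNReal _ (by positivity)
  set μ := gaussianReal m (m / l).toNNReal with hμ
  set z : ℂ := Complex.I * l - s with hz
  have hre := (abs_le.1 ((Complex.abs_re_le_norm s).trans hs))
  have him := (abs_le.1 ((Complex.abs_im_le_norm s).trans hs))
  have zre : z.re = -s.re := by simp [hz]
  have zim : z.im = l - s.im := by simp [hz]
  have split : complexMGF id (μ.restrict (Set.Ioi 0)) z
      = complexMGF id μ z - complexMGF id (μ.restrict (Set.Iic 0)) z := by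
    have := integral_add_compl (measurableSet_Ioi (a := (0 : ℝ)))
      (integrable_cexp_mul_gaussianReal m (m / l).toNNReal z)
    rw [Set.compl_Ioi] at this
    exact eq_sub_of_add_eq this
  have h1 : ‖complexMGF id μ z‖ ≤ Real.exp (-m) := by
    rw [hμ, complexMGF_id_gaussianReal, Complex.norm_exp]
    gcongr
    have e : (z * m + ((m / l).toNNReal : ℝ) * z ^ 2 / 2 : ℂ).re
        = z.re * m + m / l * (z.re ^ 2 - z.im ^ 2) / 2 := by
      rw [hcoe, show (z * m + ((m / l : ℝ) : ℂ) * z ^ 2 / 2 : ℂ)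
        = (m : ℂ) * z + ((m / l / 2 : ℝ) : ℂ) * z ^ 2 by push_cast; ring, Complex.add_re,
        Complex.re_ofReal_mul, Complex.re_ofReal_mul, sq z, Complex.mul_re]
      ring
    refine e.trans_le ?_
    rw [zre, zim]
    -- The right side is `R ^ 2 - (l - R) ^ 2`. The hypothesis `4 * R + 2 ≤ l` is what then makes `2
    -- * R - l / 2 ≤ -1`.
    have hq : (-s.re) ^ 2 - (l - s.im) ^ 2 ≤ l * (2 * R - l) := by nlinarith
    calc -s.re * m + m / l * ((-s.re) ^ 2 - (l - s.im) ^ 2) / 2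
        ≤ R * m + m / l * (l * (2 * R - l)) / 2 := by
          gcongr
          linarith
      _ = m * (2 * R - l / 2) := by field_simp; ring
      _ ≤ -m := by nlinarith
  have h2 : ‖complexMGF id (μ.restrict (Set.Iic 0)) z‖ ≤ Real.exp (-m) := by
    have hint : ∀ t : ℝ, Integrable (fun x : ℝ => Real.exp (t * id x)) μ :=
      fun t => integrable_exp_mul_gaussianReal t
    calc ‖complexMGF id (μ.restrict (Set.Iic 0)) z‖
        ≤ mgf id (μ.restrict (Set.Iic 0)) z.re := norm_complexMGF_le_mgf
      -- The exponent `-l` minimizes the moment generating function, with value `exp (-(m * l /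
      -- 2))`.
      _ ≤ ∫ x in Set.Iic (0 : ℝ), Real.exp (-l * id x) ∂μ := by
          refine setIntegral_mono_on (hint _).integrableOn (hint _).integrableOn
            measurableSet_Iic fun x hx => ?_
          have hx : x ≤ 0 := hx
          rw [Real.exp_le_exp, zre, id]
          nlinarith
      _ ≤ ∫ x, Real.exp (-l * id x) ∂μ :=
          setIntegral_le_integral (hint _) (Eventually.of_forall fun x => (Real.exp_pos _).le)
      _ = Real.exp (m * -l + (m / l) * (-l) ^ 2 / 2) := by
          have := congrFun (mgf_id_gaussianReal (μ := m) (v := (m / l).toNNReal)) (-l)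
          rw [hcoe] at this
          exact this
      _ ≤ Real.exp (-m) := by
          gcongr
          have : m * -l + (m / l) * (-l) ^ 2 / 2 = -(m * (l / 2)) := by field_simp; ring
          rw [this]
          nlinarith
  rw [split]
  linarith [norm_sub_le (complexMGF id μ z) (complexMGF id (μ.restrict (Set.Iic 0)) z)]

/-- The normalizing factor is at most linear in `m`, and `m * exp (-m) ≤ 1`. -/
lemma norm_laplaceTransform_wavePacket_le {l m R : ℝ} (hm : 1 ≤ m)
    (hR : 0 ≤ R) (hlR : 4 * R + 2 ≤ l) {s : ℂ} (hs : ‖s‖ ≤ R) :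
    ‖laplaceTransform (wavePacket l m) s‖ ≤ 4 * Real.pi := by
  have hm0 : 0 < m := by linarith
  have hl : 0 < l := by linarith
  rw [laplaceTransform_wavePacket hl hm0, norm_mul, Complex.norm_real,
    Real.norm_of_nonneg (Real.sqrt_nonneg _)]
  have h1 : √(2 * Real.pi * (m / l)) ≤ 2 * Real.pi * m := by
    rw [Real.sqrt_le_left (by positivity)]
    have hml : m / l ≤ m := div_le_self hm0.le (by linarith)
    have : 1 ≤ 2 * Real.pi * m := by nlinarith [Real.pi_gt_three]
    calc 2 * Real.pi * (m / l) ≤ 2 * Real.pi * m := by gcongr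
      _ ≤ (2 * Real.pi * m) ^ 2 := by nlinarith
  calc _ ≤ (2 * Real.pi * m) * (2 * Real.exp (-m)) := by
        gcongr
        exact norm_complexMGF_gaussianReal_Ioi_le hm0 hR hlR hs
    _ = 4 * Real.pi * (m * Real.exp (-m)) := by ring
    _ ≤ 4 * Real.pi * 1 := by
        gcongr
        rw [Real.exp_neg, ← div_eq_mul_inv, div_le_one (Real.exp_pos _)]
        linarith [Real.add_one_le_exp m]
    _ = 4 * Real.pi := mul_one _

/-! ### The superposition and its membership in the space -/

/-- Superposition of wave packets of amplitude `2⁻ⁿ` and frequency `n + 1`, centred at `m n`. -/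
noncomputable def wavePacketSum (m : ℕ → ℝ) (x : ℝ) : ℂ :=
  ∑' n : ℕ, ((1 / 2 : ℝ) ^ n : ℝ) * wavePacket (n + 1) (m n) x

lemma norm_wavePacketSum_term (m : ℕ → ℝ) (n : ℕ) (x : ℝ) :
    ‖(((1 / 2 : ℝ) ^ n : ℝ) * wavePacket (n + 1) (m n) x : ℂ)‖
      = (1 / 2) ^ n * ‖wavePacket (n + 1) (m n) x‖ := by
  rw [norm_mul, Complex.norm_real, Real.norm_of_nonneg (by positivity)]

lemma norm_wavePacketSum_term_le {m : ℕ → ℝ} (hm : ∀ n, 1 ≤ m n) (n : ℕ) (x : ℝ) :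
    ‖(((1 / 2 : ℝ) ^ n : ℝ) * wavePacket (n + 1) (m n) x : ℂ)‖ ≤ (1 / 2) ^ n := by
  rw [norm_wavePacketSum_term]
  exact mul_le_of_le_one_right (by positivity)
    (norm_wavePacket_le_one (by positivity) (by linarith [hm n]) x)

lemma summable_wavePacketSum {m : ℕ → ℝ} (hm : ∀ n, 1 ≤ m n) (x : ℝ) :
    Summable fun n : ℕ => (((1 / 2 : ℝ) ^ n : ℝ) * wavePacket (n + 1) (m n) x : ℂ) :=
  summable_geometric_two.of_norm_bounded fun n => norm_wavePacketSum_term_le hm n x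

lemma exists_hasDerivAt_wavePacketSum {m : ℕ → ℝ} (hm : ∀ n, 1 ≤ m n) :
    ∃ τ' : ℝ → ℂ, Continuous τ' ∧ Tendsto τ' atTop (𝓝 0) ∧
      ∀ x, HasDerivAt (wavePacketSum m) (τ' x) x := by
  set g : ℕ → ℝ → ℂ := fun n x => ((1 / 2 : ℝ) ^ n : ℝ) *
    ((Complex.I * (n + 1 : ℝ) - (n + 1 : ℝ) * (2 * (x - m n)) / (2 * m n))
      * wavePacket (n + 1) (m n) x) with hg
  set u : ℕ → ℝ := fun n => (1 / 2) ^ n * ((n + 1) * Real.exp 2) with hu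
  have hsum : Summable u := by
    have h1 := summable_pow_mul_geometric_of_norm_lt_one (R := ℝ) 1 (r := 1 / 2) (by norm_num)
    have h2 := ((h1.add summable_geometric_two).mul_right (Real.exp 2))
    refine h2.congr fun n => ?_
    simp only [hu]
    ring
  have hle : ∀ n x, ‖g n x‖ ≤ (1 / 2) ^ n * ((n + 1) * Real.exp (2 - |x - m n| / m n)) := by
    intro n x
    rw [hg, norm_mul, Complex.norm_real, Real.norm_of_nonneg (by positivity)]
    gcongr
    exact norm_deriv_wavePacket_le (by simp) (hm n) x
  have hle' : ∀ n x, ‖g n x‖ ≤ u n := by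
    intro n x
    refine (hle n x).trans ?_
    have : 0 ≤ |x - m n| / m n := div_nonneg (abs_nonneg _) (by linarith [hm n])
    simp only [hu]
    gcongr
    linarith
  have hcont : ∀ n, Continuous (g n) := by
    intro n
    have := continuous_wavePacket (n + 1) (m n)
    simp only [hg]
    fun_prop
  have hlim : ∀ n, Tendsto (g n) atTop (𝓝 0) := by
    intro n
    have hmn : 0 < m n := by linarith [hm n]
    refine squeeze_zero_norm (hle n) ?_
    have h1 : Tendsto (fun x => |x - m n| / m n) atTop atTop :=
      (tendsto_abs_atTop_atTop.comp (tendsto_atTop_add_const_right _ (-m n) tendsto_id)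
        |>.atTop_div_const hmn)
    have h2 : Tendsto (fun x => 2 - |x - m n| / m n) atTop atBot :=
      tendsto_atBot_add_const_left _ 2 (tendsto_neg_atTop_atBot.comp h1)
    have h3 := ((Real.tendsto_exp_atBot.comp h2).const_mul (n + 1 : ℝ)).const_mul ((1 / 2 : ℝ) ^ n)
    rwa [mul_zero, mul_zero] at h3
  refine ⟨fun x => ∑' n, g n x, continuous_tsum hcont hsum hle', ?_, fun x => ?_⟩
  -- Each term tends to `0`, and the summable majorant `u` does not depend on `x`.
  · have := tendsto_tsum_of_dominated_convergence hsum hlim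
      (Eventually.of_forall fun x n => hle' n x)
    rwa [tsum_zero] at this
  · exact hasDerivAt_tsum hsum (fun n y => (hasDerivAt_wavePacket _ _ y).const_mul _)
      (fun n y => hle' n y) (summable_wavePacketSum hm 0) x

lemma differentiable_tsum_laplaceTransform_wavePacket {m : ℕ → ℝ} (hm : ∀ n, 1 ≤ m n) :
    Differentiable ℂ fun s : ℂ =>
      ∑' n : ℕ, ((1 / 2 : ℝ) ^ n : ℝ) * laplaceTransform (wavePacket (n + 1) (m n)) s := by
  have hd : ∀ n : ℕ, Differentiable ℂ (laplaceTransform (wavePacket (n + 1) (m n))) :=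
    fun n => differentiable_laplaceTransform_wavePacket (by positivity) (by linarith [hm n])
  intro s₀
  set R : ℝ := ‖s₀‖ + 1 with hR
  have hR0 : 0 ≤ R := by positivity
  have hbdd : ∀ n : ℕ, ∃ K : ℝ, ∀ s ∈ Metric.closedBall (0 : ℂ) R,
      ‖laplaceTransform (wavePacket (n + 1) (m n)) s‖ ≤ K := fun n =>
    (isCompact_closedBall _ _).exists_bound_of_continuousOn (hd n).continuous.continuousOn
  choose K hK using hbdd
  obtain ⟨N, hN⟩ := exists_nat_ge (4 * R + 2)
  have key : DifferentiableOn ℂ (fun s : ℂ =>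
      ∑' n : ℕ, ((1 / 2 : ℝ) ^ n : ℝ) * laplaceTransform (wavePacket (n + 1) (m n)) s)
      (Metric.ball 0 R) := by
    refine Complex.differentiableOn_tsum_of_summable_norm
      -- The uniform bound needs frequency at least `4 * R + 2`; the finitely many lower ones are
      -- bounded by compactness.
      (u := fun n => (1 / 2) ^ n * if n < N then K n else 4 * Real.pi) ?_
      (fun n => ((hd n).const_mul _).differentiableOn) Metric.isOpen_ball fun n s hs => ?_
    · refine (summable_nat_add_iff N).1 ?_
      have := (summable_nat_add_iff N).2 (summable_geometric_two.mul_right (4 * Real.pi))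
      simpa using this
    · have hs' := Metric.ball_subset_closedBall hs
      rw [norm_mul, Complex.norm_real, Real.norm_of_nonneg (by positivity)]
      gcongr
      split_ifs with hn
      · exact hK n s hs'
      · have : (N : ℝ) ≤ n := by exact_mod_cast not_lt.1 hn
        exact norm_laplaceTransform_wavePacket_le (hm n) hR0 (by linarith) (by simpa using hs')
  exact key.differentiableAt (Metric.isOpen_ball.mem_nhds (by simp [hR]))

lemma laplaceTransform_wavePacketSum {m : ℕ → ℝ} (hm : ∀ n, 1 ≤ m n) {s : ℂ} (hs : 0 < s.re) :
    laplaceTransform (wavePacketSum m) s =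
      ∑' n : ℕ, ((1 / 2 : ℝ) ^ n : ℝ) * laplaceTransform (wavePacket (n + 1) (m n)) s := by
  set f : ℕ → ℝ → ℂ := fun n x =>
    (((1 / 2 : ℝ) ^ n : ℝ) * wavePacket (n + 1) (m n) x) * Complex.exp (-s * x) with hf
  have hexp : IntegrableOn (fun x : ℝ => Real.exp (-s.re * x)) (Set.Ioi 0) :=
    integrableOn_exp_mul_Ioi (by linarith) 0
  have hle : ∀ n x, ‖f n x‖ ≤ (1 / 2) ^ n * Real.exp (-s.re * x) := by
    intro n x
    rw [hf, norm_mul, Complex.norm_exp]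
    gcongr
    · exact norm_wavePacketSum_term_le hm n x
    · simp
  have hint : ∀ n, IntegrableOn (f n) (Set.Ioi 0) := by
    intro n
    have := continuous_wavePacket (n + 1) (m n)
    refine (hexp.const_mul ((1 / 2) ^ n)).mono' ?_ (Eventually.of_forall (hle n))
    exact Continuous.aestronglyMeasurable (by simp only [hf]; fun_prop)
  have hsum : Summable fun n => ∫ x in Set.Ioi (0 : ℝ), ‖f n x‖ := by
    refine Summable.of_nonneg_of_le (fun n => integral_nonneg fun x => norm_nonneg _) (fun n => ?_)
      (summable_geometric_two.mul_right (∫ x in Set.Ioi (0 : ℝ), Real.exp (-s.re * x)))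
    rw [← integral_const_mul]
    exact integral_mono (hint n).norm (hexp.const_mul _) (hle n)
  have := (hasSum_integral_of_summable_integral_norm hint hsum).tsum_eq
  rw [laplaceTransform]
  simp only [wavePacketSum, ← tsum_mul_right]
  rw [← this]
  refine tsum_congr fun n => ?_
  simp only [hf, laplaceTransform, mul_assoc]
  exact integral_const_mul _ _

lemma wavePacketSum_mem_VNegInfty {m : ℕ → ℝ} (hm : ∀ n, 1 ≤ m n) :
    wavePacketSum m ∈ VNegInfty := by
  obtain ⟨τ', hc, hlim, hd⟩ := exists_hasDerivAt_wavePacketSum hm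
  have hderiv : deriv (wavePacketSum m) = τ' := funext fun x => (hd x).deriv
  refine ⟨ContDiff.contDiffOn ?_, ?_, _,
    differentiable_tsum_laplaceTransform_wavePacket hm,
    fun s hs => (laplaceTransform_wavePacketSum hm hs).symm⟩
  · rw [contDiff_one_iff_deriv, hderiv]
    exact ⟨fun x => (hd x).differentiableAt, hc⟩
  · refine hlim.congr' ?_
    filter_upwards [eventually_ge_atTop 0] with x hx
    exact ((hd x).hasDerivWithinAt.derivWithin (uniqueDiffOn_Ici 0 x hx)).symm

/-! ### Sparse centres and the lower bound -/

lemma four_mul_le_of_lt {m : ℕ → ℝ} (h0 : 4 ≤ m 0) (hm : ∀ n, 4 * m n ≤ m (n + 1)) :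
    (∀ n, 4 * 4 ^ n ≤ m n) ∧ ∀ i j, i < j → 4 * m i ≤ m j := by
  have hpow : ∀ n, 4 * 4 ^ n ≤ m n := by
    intro n
    induction n with
    | zero => simpa using h0
    | succ n ih => rw [pow_succ]; linarith [hm n]
  have hmono : Monotone m := monotone_nat_of_le_succ fun n => by
    have : (0 : ℝ) < 4 ^ n := by positivity
    linarith [hm n, hpow n]
  exact ⟨hpow, fun i j hij => (hm i).trans (hmono hij)⟩

/-- At `m k` the `k`-th term has modulus `2⁻ᵏ`, and all the others together at most `2 * exp (-m
k)`, which is at most half of that because `m k ≥ 4 * 4 ^ k`. -/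
lemma le_norm_wavePacketSum {m : ℕ → ℝ} (h0 : 4 ≤ m 0) (hm : ∀ n, 4 * m n ≤ m (n + 1)) (k : ℕ) :
    (1 / 2) ^ k / 2 ≤ ‖wavePacketSum m (m k)‖ := by
  obtain ⟨hpow, hlt⟩ := four_mul_le_of_lt h0 hm
  have hone : ∀ n, 1 ≤ m n := fun n => by
    have : (1 : ℝ) ≤ 4 ^ n := one_le_pow₀ (by norm_num)
    linarith [hpow n]
  have hsum := summable_wavePacketSum hone (m k)
  set f : ℕ → ℂ := fun n => ((1 / 2 : ℝ) ^ n : ℝ) * wavePacket (n + 1) (m n) (m k) with hf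
  have hk : ‖f k‖ = (1 / 2) ^ k := by
    rw [hf, norm_wavePacketSum_term, norm_wavePacket_self, mul_one]
  have hrest : ‖∑' n, if n = k then 0 else f n‖ ≤ 2 * Real.exp (-m k) := by
    refine tsum_of_norm_bounded (hasSum_geometric_two.mul_right _) fun n => ?_
    split_ifs with hn
    · rw [norm_zero]; positivity
    · rw [hf, norm_wavePacketSum_term]
      gcongr
      refine norm_wavePacket_le_exp (by simp) (by linarith [hone n]) (by linarith [hone k]) ?_
      rcases lt_or_gt_of_ne hn with h | h
      · exact Or.inl (hlt _ _ h)
      · exact Or.inr (hlt _ _ h)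
  have hexp : 2 * Real.exp (-m k) ≤ (1 / 2) ^ k / 2 := by
    have h2 : (2 : ℝ) ^ k ≤ 4 ^ k := by gcongr; norm_num
    have h3 : 4 * 2 ^ k ≤ Real.exp (m k) := by
      linarith [Real.add_one_le_exp (m k), hpow k]
    have h4 : Real.exp (-m k) ≤ (4 * 2 ^ k)⁻¹ := by
      rw [Real.exp_neg]
      gcongr
    rw [mul_inv] at h4
    rw [one_div, inv_pow]
    linarith
  have : wavePacketSum m (m k) = f k + ∑' n, if n = k then 0 else f n :=
    hsum.tsum_eq_add_tsum_ite k
  rw [this]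
  have := norm_sub_le_norm_add (f k) (∑' n, if n = k then 0 else f n)
  linarith

lemma exists_seq_four_mul_le {p : ℕ → ℝ → Prop} (hp : ∀ n, ∀ᶠ x in atTop, p n x) :
    ∃ m : ℕ → ℝ, 4 ≤ m 0 ∧ (∀ n, 4 * m n ≤ m (n + 1)) ∧ ∀ n, p n (m n) := by
  have : ∀ n y, ∃ x, y ≤ x ∧ p n x := fun n y => ((eventually_ge_atTop y).and (hp n)).exists
  choose f hle hf using this
  refine ⟨fun n => Nat.rec (f 0 4) (fun n y => f (n + 1) (4 * y)) n, hle _ _, fun n => hle _ _,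
    fun n => ?_⟩
  cases n <;> exact hf _ _

theorem theorem1p2 (ρ : ℝ → ℝ) (hρ_pos : ∀ x : ℝ, 0 ≤ x → 0 < ρ x)
    (hρ_lim : Tendsto ρ atTop (𝓝 0)) :
    ∃ τ ∈ VNegInfty, limsup (fun x : ℝ => ((‖τ x‖ / ρ x : ℝ) : EReal)) atTop = ⊤ := by
  -- Against a sum of size `2⁻ⁿ / 2`, the rate `4⁻ⁿ` makes the ratio at least `2 ^ n / 2`.
  obtain ⟨m, h0, hm, hρ⟩ := exists_seq_four_mul_le (p := fun n x => ρ x ≤ (1 / 4) ^ n)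
    fun n => hρ_lim.eventually_le_const (by positivity)
  obtain ⟨hpow, -⟩ := four_mul_le_of_lt h0 hm
  have hone : ∀ n, 1 ≤ m n := fun n => by
    have : (1 : ℝ) ≤ 4 ^ n := one_le_pow₀ (by norm_num)
    linarith [hpow n]
  refine ⟨wavePacketSum m, wavePacketSum_mem_VNegInfty hone, ?_⟩
  have hratio : ∀ n, 2 ^ n / 2 ≤ ‖wavePacketSum m (m n)‖ / ρ (m n) := by
    intro n
    have hpos := hρ_pos (m n) (by linarith [hone n])
    rw [le_div_iff₀ hpos]
    refine le_trans ?_ (le_norm_wavePacketSum h0 hm n)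
    calc (2 : ℝ) ^ n / 2 * ρ (m n) ≤ 2 ^ n / 2 * (1 / 4) ^ n := by gcongr; exact hρ n
      _ = (2 * (1 / 4)) ^ n / 2 := by rw [mul_pow]; ring
      _ = (1 / 2) ^ n / 2 := by norm_num
  have hm_top : Tendsto m atTop atTop :=
    tendsto_atTop_mono hpow
      ((tendsto_pow_atTop_atTop_of_one_lt (by norm_num : (1 : ℝ) < 4)).const_mul_atTop (by norm_num))
  have htop : Tendsto (fun n => ‖wavePacketSum m (m n)‖ / ρ (m n)) atTop atTop :=
    tendsto_atTop_mono hratio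
      ((tendsto_pow_atTop_atTop_of_one_lt (by norm_num : (1 : ℝ) < 2)).atTop_div_const (by norm_num))
  refine (EReal.eq_top_iff_forall_lt _).2 fun b => ?_
  refine lt_of_lt_of_le (EReal.coe_lt_coe_iff.2 (lt_add_one b))
    (le_limsup_of_frequently_le' (hm_top.frequently (Eventually.frequently ?_)))
  filter_upwards [htop.eventually_ge_atTop (b + 1)] with n hn
  exact EReal.coe_le_coe_iff.2 hn
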